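/- Throughout, $u v^\dagger$ is the rank-one matrix of column vectors $u,v$, $\|\cdot\|_{HS}$ is the Hilbert–Schmidt norm, "h.c." is the conjugate transpose of the preceding term, and $\mathbb E_\theta$ is the expectation over $y\sim\theta$. **Setting.** Consider on $[0,T]$ the SDE $dX=a(X,t)\,dt+\sum_{j=1}^N b_j(X,t)\,dW_j$ in $\mathbb C^n$, with measurable coefficients and independent real standard Brownian motions $W_j$. Its generator is $(\mathcal A_t^*f)(x)=Df(x)[a(x,t)]+\frac12\sum_j D^2f(x)[b_j(x,t),b_j(x,t)]$ (real derivatives), and its Fokker–Planck operator $\mathcal A_t$ is defined by duality, $\int f\,d(\mathcal A_t\mu)=\int \mathcal A_t^*f\,d\mu$. With the single test function $f(x)=xx^\dagger$ put $d_{\mathsf F}(\nu_1,\nu_2)=\|\int f\,d\nu_1-\int f\,d\nu_2\|_{HS}$. For $t\in[0,T]$ let $U(t)\in\mathbb C^{n\times r}$ with $U(t)^\dagger U(t)=\mathrm{Id}$, let $\theta_t$ be a probability measure on $\mathbb C^r$ with finite second moment, and let $\mu_{LR,t}$ be the law of $U(t)y$, $y\sim\theta_t$. Put $\mathcal P_U=UU^\dagger$,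 $\mathcal Q_U=\mathrm{Id}-\mathcal P_U$. Assume $\mathbb E_{\theta_t}\big[|a(U(t)y,t)|\,|y|\big]<\infty$ and $\mathbb E_{\theta_t}\big[|b_j(U(t)y,t)|^2\big]<\infty$. A low-rank dynamics is given by $M\in\mathbb N$, coefficients $A,B_1,\dots,B_M$ on $\mathbb C^r$ and a matrix $G(t)$ with $$\dot U=iG U,\qquad G^\dagger=G,\qquad G=\mathcal Q_UG\mathcal P_U+\text{h.c.},\qquad dY=A(Y,t)\,dt+\sum_{j=1}^M B_j(Y,t)\,dW_j .\tag{1}$$ Its operator $\widetilde{\mathcal A}_{LR,t}$ is the Fokker–Planck operator with coefficients $a_{LR}(x)=iG(t)x+U(t)A(U(t)^\dagger x,t)$ and $b_{LR,j}(x)=U(t)B_j(U(t)^\dagger x,t)$. At each time we consider all $M$, measurable $A,B_j$, and $G$ satisfying the restriction in (1), for which $\widetilde{\mathcal A}_{LR,t}^*f$ is $\mu_{LR,t}$-integrable. **Theorem.** Assume that $\mathbb E_{\theta_t}[yy^\dagger]$ is invertible for all $t\in[0,T]$. (i) The following choice is admissible and optimal: $M=N$, $A(y,t)=U^\dagger a(Uy,t)$,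 $B_j(y,t)=U^\dagger b_j(Uy,t)$ and $$G=-i\,\mathcal Q_U\Big(\mathbb E_{\theta_t}\big[a(Uy,t)(Uy)^\dagger\big]+\sum_{j=1}^N\mathbb E_{\theta_t}\big[b_j(Uy,t)b_j(Uy,t)^\dagger\big]\Big)U\,\mathbb E_{\theta_t}[yy^\dagger]^{-1}U^\dagger+\text{h.c.}$$ (where $U=U(t)$). (ii) That is, for every $t\in[0,T]$, with $\mathcal A_{LR,t}$ the operator of this choice, $$\min_{\widetilde{\mathcal A}_{LR,t}}d_{\mathsf F}\big(\widetilde{\mathcal A}_{LR,t}\mu_{LR,t},\mathcal A_t\mu_{LR,t}\big)=d_{\mathsf F}\big(\mathcal A_{LR,t}\mu_{LR,t},\mathcal A_t\mu_{LR,t}\big)=\Big\|\sum_{j=1}^N\mathcal Q_{U}\,\mathbb E_{\theta_t}\big[b_j(Uy,t)b_j(Uy,t)^\dagger\big]\mathcal Q_{U}\Big\|_{HS}.$$ Moreover every admissible minimizer has the same matrix $G$, namely the one in (i). (iii) Let $Y$ be a process on $[0,T]$ on a filtered probability space carrying $N$ independent Brownian motions, with $Y_t\sim\theta_t$ for all $t\in[0,T]$.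 Then $(U,Y)$ follows (1) with the choice in (i) if and only if it solves the coupled system $$dY=U^\dagger a(UY,t)\,dt+\sum_{j=1}^N U^\dagger b_j(UY,t)\,dW_j,$$ $$\frac{dU}{dt}=\mathcal Q_U\Big(\mathbb E\big[a(UY,t)Y^\dagger\big]+\sum_{j=1}^N\mathbb E\big[b_j(UY,t)b_j(UY,t)^\dagger\big]U\Big)\mathbb E[YY^\dagger]^{-1}.$$ If $r=n$, then $\mathcal Q_{U(t)}=0$ and $\mathcal P_{U(t)}=\mathrm{Id}$, and for the choice in (i) $a_{LR}=a$ and $b_{LR,j}=b_j$, so that the generator of $X_{LR}=UY$ is that of $X$ and the two (weak) Fokker–Planck equations have the same solutions; and along every solution $(U,Y)$ of the coupled system $dU/dt=0$ and $X_{LR}=UY$ solves the original SDE. -/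

import Mathlib

open MeasureTheory ProbabilityTheory Filter Topology
open scoped NNReal ENNReal Matrix

-- Matrices carry the Hilbert-Schmidt (Frobenius) norm.
attribute [local instance] Matrix.frobeniusNormedAddCommGroup Matrix.frobeniusNormedSpace

namespace SDLR

/-- The space of column vectors with `n` complex entries. Only its (real) vector space structure,
its topology and its Borel sigma-algebra matter below; its norm is used only up to equivalence. -/
abbrev CVec (n : ℕ) : Type := Fin n → ℂ

/-- The rank-one matrix `u v†`. -/
def outer {m n : ℕ} (u : CVec m) (v : CVec n) : Matrix (Fin m) (Fin n) ℂ :=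
  Matrix.vecMulVec u (star v)

/-- The expectation `E[g h†]` (entrywise). -/
noncomputable def expOuter {Ω : Type*} [MeasurableSpace Ω] {m n : ℕ} (P : Measure Ω)
    (g : Ω → CVec m) (h : Ω → CVec n) : Matrix (Fin m) (Fin n) ℂ :=
  Matrix.of fun i k => ∫ ω, outer (g ω) (h ω) i k ∂P

/-! ### Generators, the Fokker-Planck operator and the pseudometric -/

section Generator

variable {n N : ℕ} {F : Type*} [NormedAddCommGroup F] [NormedSpace ℝ F]

/-- The infinitesimal generator of `dX = a(X) dt + ∑ⱼ bⱼ(X) dWⱼ` with real Brownian motions `Wⱼ`,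
applied to a function `f` of the real vector space `ℂⁿ`:
`(𝒜* f)(x) = Df(x)[a(x)] + ½ ∑ⱼ D²f(x)[bⱼ(x), bⱼ(x)]` (real derivatives). -/
noncomputable def generator (a : CVec n → CVec n) (b : Fin N → CVec n → CVec n)
    (f : CVec n → F) (x : CVec n) : F :=
  fderiv ℝ f x (a x) + (1 / 2 : ℝ) • ∑ j, fderiv ℝ (fderiv ℝ f) x (b j x) (b j x)

/-- The Fokker-Planck operator applied to a measure. The result `𝒜 μ` is given by duality, as the
functional `f ↦ ∫ f d(𝒜 μ) = ∫ 𝒜* f dμ` on test functions. -/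
noncomputable def fokkerPlanck (a : CVec n → CVec n) (b : Fin N → CVec n → CVec n)
    (μ : Measure (CVec n)) (f : CVec n → F) : F :=
  ∫ x, generator a b f x ∂μ

/-- The integral `∫ 𝒜* f dμ` exists. -/
def PairingExists (a : CVec n → CVec n) (b : Fin N → CVec n → CVec n)
    (μ : Measure (CVec n)) (f : CVec n → F) : Prop :=
  Integrable (generator a b f) μ

/-- The pseudometric `d_𝓣(ν₁, ν₂) = sup_{f ∈ 𝓣} ‖∫ f dν₁ - ∫ f dν₂‖`. -/
noncomputable def dTest (𝓣 : Set (CVec n → F)) (ν₁ ν₂ : (CVec n → F) → F) : ℝ≥0∞ :=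
  ⨆ f ∈ 𝓣, ‖ν₁ f - ν₂ f‖ₑ

end Generator

/-- The test function `f(x) = x x†`. -/
def squareFun (n : ℕ) (x : CVec n) : Matrix (Fin n) (Fin n) ℂ := outer x x

/-- The probability measures `(μ_t)` solve, on `[0, T]`, the Fokker-Planck equation of
`dX = a(X, t) dt + ∑ⱼ bⱼ(X, t) dWⱼ` in the sense of distributions. -/
def SolvesFokkerPlanck {n N : ℕ} (T : ℝ) (a : ℝ → CVec n → CVec n)
    (b : Fin N → ℝ → CVec n → CVec n) (μ : ℝ → Measure (CVec n)) : Prop :=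
  (∀ t ∈ Set.Icc 0 T, IsProbabilityMeasure (μ t)) ∧
  ∀ φ : CVec n → ℝ, ContDiff ℝ (⊤ : ℕ∞) φ → HasCompactSupport φ → ∀ t ∈ Set.Icc 0 T,
    PairingExists (a t) (fun j => b j t) (μ t) φ ∧
    HasDerivWithinAt (fun s => ∫ x, φ x ∂μ s)
      (fokkerPlanck (a t) (fun j => b j t) (μ t) φ) (Set.Icc 0 T) t

/-! ### The low-rank manifold and its tangent directions -/

section LowRank

variable {n r N : ℕ}

/-- The Stiefel manifold `V_r(ℂⁿ)`. -/
def stiefel (n r : ℕ) : Set (Matrix (Fin n) (Fin r) ℂ) := {U | Uᴴ * U = 1}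

/-- `𝒫_U = U U†`. -/
def projP (U : Matrix (Fin n) (Fin r) ℂ) : Matrix (Fin n) (Fin n) ℂ := U * Uᴴ

/-- `𝒬_U = Id - U U†`. -/
def projQ (U : Matrix (Fin n) (Fin r) ℂ) : Matrix (Fin n) (Fin n) ℂ := 1 - projP U

/-- The restriction on the direction `i G U` in the tangent space of the Stiefel manifold at `U`:
`G† = G` and `G = 𝒬_U G 𝒫_U + h.c.` -/
def IsGauge (U : Matrix (Fin n) (Fin r) ℂ) (G : Matrix (Fin n) (Fin n) ℂ) : Prop :=
  Gᴴ = G ∧ G = projQ U * G * projP U + (projQ U * G * projP U)ᴴ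

/-- The measure on `ℂⁿ`, carried by `Ran U`, that corresponds to the pair `(U, θ)`:
the law of `U Y` for `Y ∼ θ`. -/
noncomputable def lowRankMeasure (U : Matrix (Fin n) (Fin r) ℂ) (θ : Measure (CVec r)) :
    Measure (CVec n) :=
  θ.map (fun y => U *ᵥ y)

/-- The parameters, at a fixed time, of a low-rank diffusion
`U̇ = i G U`, `dY = A(Y) dt + ∑_{j ≤ M} B_j(Y) dW_j`. -/
structure Params (n r : ℕ) where
  /-- the number of driving Brownian motions -/
  M : ℕ
  /-- the drift of `Y` -/
  A : CVec r → CVec r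
  /-- the diffusion vectors of `Y` -/
  B : Fin M → CVec r → CVec r
  /-- the direction of motion of `U` -/
  G : Matrix (Fin n) (Fin n) ℂ

/-- The drift of `X_LR = U Y`: `a_LR(x) = i G x + U A(U† x)`. -/
noncomputable def Params.aLR (p : Params n r) (U : Matrix (Fin n) (Fin r) ℂ) (x : CVec n) :
    CVec n :=
  Complex.I • (p.G *ᵥ x) + U *ᵥ p.A (Uᴴ *ᵥ x)

/-- The diffusion vectors of `X_LR = U Y`: `b_{LR,j}(x) = U B_j(U† x)`. -/
def Params.bLR (p : Params n r) (U : Matrix (Fin n) (Fin r) ℂ) (j : Fin p.M) (x : CVec n) :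
    CVec n :=
  U *ᵥ p.B j (Uᴴ *ᵥ x)

/-- The parameters over which one minimizes at `(U, θ)`: measurable coefficients, the restriction on
`G`, and existence of the expectation of `𝒜*_LR f`, `f(x) = x x†`, in the pseudometric. -/
structure Params.Admissible (p : Params n r) (U : Matrix (Fin n) (Fin r) ℂ)
    (θ : Measure (CVec r)) : Prop where
  measurable_A : Measurable p.A
  measurable_B : ∀ j, Measurable (p.B j)
  gauge : IsGauge U p.G
  integrable : PairingExists (p.aLR U) (p.bLR U) (lowRankMeasure U θ) (squareFun n)

/-- The distance `d_𝓣(𝒜_LR μ_LR, 𝒜 μ_LR)` for the single test function `f(x) = x x†`. -/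
noncomputable def Params.residual (p : Params n r) (a : CVec n → CVec n)
    (b : Fin N → CVec n → CVec n) (U : Matrix (Fin n) (Fin r) ℂ) (θ : Measure (CVec r)) : ℝ≥0∞ :=
  dTest {squareFun n} (fokkerPlanck (p.aLR U) (p.bLR U) (lowRankMeasure U θ))
    (fokkerPlanck a b (lowRankMeasure U θ))

/-- `-i 𝒬_U (E_θ[a(Uy)(Uy)†] + ∑ⱼ E_θ[bⱼ(Uy) bⱼ(Uy)†]) U E_θ[yy†]⁻¹ U† + h.c.` -/
noncomputable def optG (a : CVec n → CVec n) (b : Fin N → CVec n → CVec n)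
    (U : Matrix (Fin n) (Fin r) ℂ) (θ : Measure (CVec r)) : Matrix (Fin n) (Fin n) ℂ :=
  let K := (-Complex.I) • (projQ U *
    (expOuter θ (fun y => a (U *ᵥ y)) (fun y => U *ᵥ y) +
      ∑ j, expOuter θ (fun y => b j (U *ᵥ y)) (fun y => b j (U *ᵥ y))) *
    U * (expOuter θ (fun y => y) (fun y => y))⁻¹ * Uᴴ)
  K + Kᴴ

/-- The explicit choice `M = N`, `A(y) = U† a(Uy)`, `B_j(y) = U† b_j(Uy)`, `G = optG`. -/
noncomputable def optParams (a : CVec n → CVec n) (b : Fin N → CVec n → CVec n)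
    (U : Matrix (Fin n) (Fin r) ℂ) (θ : Measure (CVec r)) : Params n r where
  M := N
  A := fun y => Uᴴ *ᵥ a (U *ᵥ y)
  B := fun j y => Uᴴ *ᵥ b j (U *ᵥ y)
  G := optG a b U θ

end LowRank

/-! ### Stochastic differential equations -/

section SDE

variable {Ω : Type*} [mΩ : MeasurableSpace Ω]

/-- `W` is a family of independent standard real Brownian motions with respect to the
filtration `𝓕` (only times `t ≥ 0` matter). -/
structure IsBrownianFamily {N : ℕ} (𝓕 : Filtration ℝ mΩ) (P : Measure Ω)
    (W : Fin N → ℝ → Ω → ℝ) : Prop where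
  brownian : ∀ j, IsBrownianReal (fun t : ℝ≥0 => W j t) P
  indep : iIndepFun (fun j ω (t : ℝ≥0) => W j t ω) P
  adapted : ∀ j, ∀ t, 0 ≤ t → StronglyMeasurable[𝓕 t] (W j t)
  increments : ∀ s t, 0 ≤ s → s ≤ t →
    Indep (MeasurableSpace.comap (fun ω j => W j t ω - W j s ω) inferInstance) (𝓕 s) P

/-- A simple predictable process `∑_{i < m} ξᵢ 1_{(τᵢ, τᵢ₊₁]}` with deterministic times
`0 ≤ τ₀ ≤ τ₁ ≤ ⋯` and bounded `𝓕_{τᵢ}`-measurable values `ξᵢ`. -/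
structure SimpleProc (𝓕 : Filtration ℝ mΩ) (d : ℕ) where
  m : ℕ
  τ : ℕ → ℝ
  ξ : ℕ → Ω → CVec d
  nonneg : 0 ≤ τ 0
  mono : Monotone τ
  measurable : ∀ i, StronglyMeasurable[𝓕 (τ i)] (ξ i)
  bounded : ∃ C : ℝ, ∀ i ω, ‖ξ i ω‖ ≤ C

/-- The value of a simple process. -/
noncomputable def SimpleProc.eval {𝓕 : Filtration ℝ mΩ} {d : ℕ} (S : SimpleProc 𝓕 d) (t : ℝ)
    (ω : Ω) : CVec d :=
  ∑ i ∈ Finset.range S.m, (Set.Ioc (S.τ i) (S.τ (i + 1))).indicator (fun _ => S.ξ i ω) t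

/-- The elementary stochastic integral `∫₀ᵗ S dW` of a simple process. -/
noncomputable def SimpleProc.integral {𝓕 : Filtration ℝ mΩ} {d : ℕ} (S : SimpleProc 𝓕 d)
    (W : ℝ → Ω → ℝ) (t : ℝ) (ω : Ω) : CVec d :=
  ∑ i ∈ Finset.range S.m, (W (min (S.τ (i + 1)) t) ω - W (min (S.τ i) t) ω) • S.ξ i ω

/-- `J` is (a continuous version of) the Itô integral `J t = ∫₀ᵗ H dW`, `0 ≤ t ≤ T`: there are
simple processes `Sₖ` with `∫₀ᵀ |Sₖ - H|² ds → 0` and `∫₀ᵗ Sₖ dW → J t` in probability. -/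
def IsItoIntegral {d : ℕ} (𝓕 : Filtration ℝ mΩ) (P : Measure Ω) (T : ℝ) (W : ℝ → Ω → ℝ)
    (H J : ℝ → Ω → CVec d) : Prop :=
  (∀ᵐ ω ∂P, ContinuousOn (fun t => J t ω) (Set.Icc 0 T)) ∧
  ∃ S : ℕ → SimpleProc 𝓕 d,
    (∀ ε : ℝ≥0∞, 0 < ε → Tendsto
      (fun k => P {ω | ε ≤ ∫⁻ s in Set.Icc 0 T, ‖(S k).eval s ω - H s ω‖ₑ ^ 2}) atTop (𝓝 0)) ∧
    ∀ t ∈ Set.Icc 0 T, TendstoInMeasure P (fun k => (S k).integral W t) atTop (J t)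

/-- `Y` solves `dY = A(Y, t) dt + ∑ⱼ Bⱼ(Y, t) dWⱼ` on `[0, T]`. -/
structure SolvesSDE {d N : ℕ} (𝓕 : Filtration ℝ mΩ) (P : Measure Ω) (T : ℝ)
    (W : Fin N → ℝ → Ω → ℝ) (A : ℝ → CVec d → CVec d) (B : Fin N → ℝ → CVec d → CVec d)
    (Y : ℝ → Ω → CVec d) : Prop where
  adapted : ∀ t ∈ Set.Icc 0 T, StronglyMeasurable[𝓕 t] (Y t)
  continuous : ∀ᵐ ω ∂P, ContinuousOn (fun t => Y t ω) (Set.Icc 0 T)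
  integrable : ∀ᵐ ω ∂P, IntegrableOn (fun s => A s (Y s ω)) (Set.Icc 0 T)
  equation : ∃ J : Fin N → ℝ → Ω → CVec d,
    (∀ j, IsItoIntegral 𝓕 P T (W j) (fun s ω => B j s (Y s ω)) (J j)) ∧
    ∀ᵐ ω ∂P, ∀ t ∈ Set.Icc 0 T,
      Y t ω = Y 0 ω + (∫ s in (0 : ℝ)..t, A s (Y s ω)) + ∑ j, J j t ω

/-- The low-rank stochastic dynamics with given `G`, `A`, `B`:
`U̇ = i G U` with `G† = G`, `G = 𝒬_U G 𝒫_U + h.c.`, and `dY = A(Y, t) dt + ∑ⱼ Bⱼ(Y, t) dWⱼ`. -/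
structure IsLowRankDynamics {n r M : ℕ} (𝓕 : Filtration ℝ mΩ) (P : Measure Ω) (T : ℝ)
    (W : Fin M → ℝ → Ω → ℝ) (G : ℝ → Matrix (Fin n) (Fin n) ℂ) (A : ℝ → CVec r → CVec r)
    (B : Fin M → ℝ → CVec r → CVec r) (U : ℝ → Matrix (Fin n) (Fin r) ℂ)
    (Y : ℝ → Ω → CVec r) : Prop where
  gauge : ∀ t ∈ Set.Icc 0 T, IsGauge (U t) (G t)
  ode : ∀ t ∈ Set.Icc 0 T, HasDerivWithinAt U (Complex.I • (G t * U t)) (Set.Icc 0 T) t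
  sde : SolvesSDE 𝓕 P T W A B Y

/-- The coupled ODE-SDE system
`dY = U† a(U Y, t) dt + ∑ⱼ U† bⱼ(U Y, t) dWⱼ`,
`dU/dt = 𝒬_U (E[a(U Y, t) Y†] + ∑ⱼ E[bⱼ(U Y, t) bⱼ(U Y, t)†] U) E[Y Y†]⁻¹`. -/
structure IsCoupledSystem {n r N : ℕ} (𝓕 : Filtration ℝ mΩ) (P : Measure Ω) (T : ℝ)
    (W : Fin N → ℝ → Ω → ℝ) (a : ℝ → CVec n → CVec n) (b : Fin N → ℝ → CVec n → CVec n)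
    (U : ℝ → Matrix (Fin n) (Fin r) ℂ) (Y : ℝ → Ω → CVec r) : Prop where
  sde : SolvesSDE 𝓕 P T W (fun t y => (U t)ᴴ *ᵥ a t (U t *ᵥ y))
    (fun j t y => (U t)ᴴ *ᵥ b j t (U t *ᵥ y)) Y
  ode : ∀ t ∈ Set.Icc 0 T, HasDerivWithinAt U
    (projQ (U t) *
      (expOuter P (fun ω => a t (U t *ᵥ Y t ω)) (fun ω => Y t ω) +
        (∑ j, expOuter P (fun ω => b j t (U t *ᵥ Y t ω)) (fun ω => b j t (U t *ᵥ Y t ω))) * U t) *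
      (expOuter P (fun ω => Y t ω) (fun ω => Y t ω))⁻¹)
    (Set.Icc 0 T) t

end SDE

end SDLR

/-! For `f(x) = x x†` the generator is explicit: `a x† + x a† + ∑ⱼ bⱼ bⱼ†`. The distance is
therefore the Hilbert–Schmidt norm of a Hermitian matrix `D`, the averaged low-rank generator minus
the averaged original one, both evaluated at `x = Uy`. Split `D` into blocks along `Ran U` and its
complement.

The block `QDQ` does not depend on the parameters: `x = Uy` and every `b_LR` lie in `Ran U`, so only
`-∑ⱼ Q E[bⱼ bⱼ†] Q` survives (`projQ_mul_defect_mul_projQ`). By Pythagoras (`norm_sq_projQ_le`) its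
norm bounds every competitor from below.

The block `QDU` sees only `G`: it equals `i QGU E[yy†]` minus a fixed matrix
(`projQ_mul_defect_mul`). Since `E[yy†]` is invertible, exactly one value of `QGU` makes it vanish,
and `QGU` determines a gauged `G`. The block `U†DU` vanishes for `A = U†a`, `B = U†b`, because `U†GU
= 0`. Hence the explicit choice leaves only `QDQ` and attains the bound (`defect_optParams`), while
equality for a competitor forces `QDP = 0`, hence the same `G`.

For (iii), `i G U` with the optimal `G` is the right-hand side of the equation for `U`, rewritten
through the law of `Y` (`I_smul_optG_mul`). If `r = n` then `Q = 0`, so `U` is constant and `UY` is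
a fixed linear image of `Y`; stochastic integrals pass through such maps (`SolvesSDE.map`). -/

namespace SDLR

/-- The topology of the Hilbert-Schmidt norm, as the topology found by instance search. -/
noncomputable abbrev frobeniusTopology (m n : ℕ) : TopologicalSpace (Matrix (Fin m) (Fin n) ℂ) :=
  (Matrix.frobeniusNormedAddCommGroup (m := Fin m) (n := Fin n)
    (α := ℂ)).toPseudoMetricSpace.toUniformSpace.toTopologicalSpace

/-! ### Rank-one matrices, the generator of `x x†`, and matrix-valued integrals. -/

section Outer

attribute [local instance] frobeniusTopology

variable {l m n : ℕ}

lemma outer_mulVec_left (V : Matrix (Fin l) (Fin m) ℂ) (u : CVec m) (v : CVec n) :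
    outer (V *ᵥ u) v = V * outer u v := by
  simp [outer, Matrix.mul_vecMulVec]

lemma outer_mulVec_right (V : Matrix (Fin l) (Fin n) ℂ) (u : CVec m) (v : CVec n) :
    outer u (V *ᵥ v) = outer u v * Vᴴ := by
  simp [outer, Matrix.vecMulVec_mul, Matrix.star_mulVec]

lemma conjTranspose_outer (u : CVec m) (v : CVec n) : (outer u v)ᴴ = outer v u := by
  simp [outer, Matrix.conjTranspose_vecMulVec]

/-- The map `(u, v) ↦ u v†` as a continuous real bilinear map. -/
noncomputable def outerCLM (m n : ℕ) :
    CVec m →L[ℝ] CVec n →L[ℝ] Matrix (Fin m) (Fin n) ℂ :=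
  LinearMap.toContinuousLinearMap
    ((LinearMap.toContinuousLinearMap (𝕜 := ℝ) (E := CVec n)
      (F' := Matrix (Fin m) (Fin n) ℂ)).toLinearMap.comp
    (LinearMap.mk₂ ℝ (outer (m := m) (n := n))
      (fun u u' v => by simp [outer, Matrix.add_vecMulVec])
      (fun c u v => by simp [outer, Matrix.smul_vecMulVec])
      (fun u v v' => by simp [outer, Matrix.vecMulVec_add])
      (fun c u v => by ext; simp [outer, Matrix.vecMulVec_apply]; ring)))

@[simp] lemma outerCLM_apply (u : CVec m) (v : CVec n) : outerCLM m n u v = outer u v := rfl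

lemma outer_add_left (u u' : CVec m) (v : CVec n) :
    outer (u + u') v = outer u v + outer u' v := by
  simp [← outerCLM_apply]

lemma outer_smul_left (c : ℂ) (u : CVec m) (v : CVec n) :
    outer (c • u) v = c • outer u v := by
  simp [outer, Matrix.smul_vecMulVec]

/-- Phrased as an equality of functions with a continuous linear map on the right, so that
differentiating once more is immediate and the second derivative is constant. -/
lemma fderiv_bilinear_self {E F : Type*} [NormedAddCommGroup E] [NormedSpace ℝ E]
    [NormedAddCommGroup F] [NormedSpace ℝ F] (B : E →L[ℝ] E →L[ℝ] F) :
    fderiv ℝ (fun x => B x x) = ⇑(B + B.flip) := by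
  ext1 x
  refine HasFDerivAt.fderiv ?_
  have h : (B + B.flip) x = B.precompR E (id x) (.id ℝ E) + B.precompL E (.id ℝ E) (id x) := by
    ext v
    simp
  rw [h]
  exact B.hasFDerivAt_of_bilinear (hasFDerivAt_id x) (hasFDerivAt_id x)

/-- The second derivative of `x x†` along `(v, v)` is `2 v v†`, which absorbs the factor `1/2`. -/
lemma generator_squareFun {N : ℕ} (a : CVec n → CVec n) (b : Fin N → CVec n → CVec n)
    (x : CVec n) :
    generator a b (squareFun n) x =
      outer (a x) x + outer x (a x) + ∑ j, outer (b j x) (b j x) := by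
  have hf : fderiv ℝ (squareFun n) = ⇑(outerCLM n n + (outerCLM n n).flip) :=
    fderiv_bilinear_self (outerCLM n n)
  unfold generator
  rw [hf, ContinuousLinearMap.fderiv]
  simp only [_root_.add_apply, ContinuousLinearMap.flip_apply, outerCLM_apply,
    Finset.smul_sum]
  rw [add_comm (outer x (a x))]
  congr 1
  refine Finset.sum_congr rfl fun j _ => ?_
  rw [← two_smul ℝ, smul_smul]
  norm_num

lemma aestronglyMeasurable_outer {Ω : Type*} [MeasurableSpace Ω] {P : Measure Ω}
    {g : Ω → CVec m} {h : Ω → CVec n} (hg : AEStronglyMeasurable g P)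
    (hh : AEStronglyMeasurable h P) :
    AEStronglyMeasurable (fun ω => outer (g ω) (h ω)) P :=
  (outerCLM m n).aestronglyMeasurable_comp₂ hg hh

lemma integrable_outer {Ω : Type*} [MeasurableSpace Ω] {P : Measure Ω}
    {g : Ω → CVec m} {h : Ω → CVec n} (hg : AEStronglyMeasurable g P)
    (hh : AEStronglyMeasurable h P) (hgh : Integrable (fun ω => ‖g ω‖ * ‖h ω‖) P) :
    Integrable (fun ω => outer (g ω) (h ω)) P := by
  refine (hgh.const_mul ‖outerCLM m n‖).mono' (aestronglyMeasurable_outer hg hh) ?_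
  refine .of_forall fun ω => ?_
  rw [← mul_assoc]
  exact (outerCLM m n).le_opNorm₂ (g ω) (h ω)

lemma integral_linearMap_comp {Ω E F : Type*} [MeasurableSpace Ω] [NormedAddCommGroup E]
    [NormedSpace ℝ E] [FiniteDimensional ℝ E] [NormedAddCommGroup F] [NormedSpace ℝ F]
    [FiniteDimensional ℝ F] {P : Measure Ω} {f : Ω → E} (hf : Integrable f P) (L : E →ₗ[ℝ] F) :
    ∫ ω, L (f ω) ∂P = L (∫ ω, f ω ∂P) :=
  haveI := FiniteDimensional.complete ℝ E
  haveI := FiniteDimensional.complete ℝ F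
  (LinearMap.toContinuousLinearMap L).integral_comp_comm hf

lemma integral_mul_const {Ω : Type*} [MeasurableSpace Ω] {P : Measure Ω}
    {f : Ω → Matrix (Fin l) (Fin m) ℂ} (hf : Integrable f P) (R : Matrix (Fin m) (Fin n) ℂ) :
    ∫ ω, f ω * R ∂P = (∫ ω, f ω ∂P) * R :=
  integral_linearMap_comp hf (mulRightLinearMap (Fin l) ℝ R)

lemma integral_mul_mul {Ω : Type*} [MeasurableSpace Ω] {P : Measure Ω} {k : ℕ}
    {f : Ω → Matrix (Fin l) (Fin m) ℂ} (hf : Integrable f P) (V : Matrix (Fin k) (Fin l) ℂ)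
    (R : Matrix (Fin m) (Fin n) ℂ) :
    ∫ ω, V * f ω * R ∂P = V * (∫ ω, f ω ∂P) * R :=
  integral_linearMap_comp hf
    ((mulRightLinearMap (Fin k) ℝ R).comp (mulLeftLinearMap (Fin m) ℝ V))

lemma integral_conjTranspose {Ω : Type*} [MeasurableSpace Ω] {P : Measure Ω}
    {f : Ω → Matrix (Fin l) (Fin m) ℂ} (hf : Integrable f P) :
    ∫ ω, (f ω)ᴴ ∂P = (∫ ω, f ω ∂P)ᴴ :=
  integral_linearMap_comp hf
    (Matrix.conjTransposeLinearEquiv (Fin l) (Fin m) ℝ ℂ).toLinearMap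

lemma integrable_const_mul {Ω : Type*} [MeasurableSpace Ω] {P : Measure Ω} {k : ℕ}
    {f : Ω → Matrix (Fin l) (Fin m) ℂ} (hf : Integrable f P) (V : Matrix (Fin k) (Fin l) ℂ) :
    Integrable (fun ω => V * f ω) P :=
  (LinearMap.toContinuousLinearMap (mulLeftLinearMap (Fin m) ℝ V)).integrable_comp hf

lemma integrable_mul_const {Ω : Type*} [MeasurableSpace Ω] {P : Measure Ω}
    {f : Ω → Matrix (Fin l) (Fin m) ℂ} (hf : Integrable f P) (R : Matrix (Fin m) (Fin n) ℂ) :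
    Integrable (fun ω => f ω * R) P :=
  (LinearMap.toContinuousLinearMap (mulRightLinearMap (Fin l) ℝ R)).integrable_comp hf

lemma integral_const_mul {Ω : Type*} [MeasurableSpace Ω] {P : Measure Ω} {k : ℕ}
    {f : Ω → Matrix (Fin l) (Fin m) ℂ} (hf : Integrable f P) (V : Matrix (Fin k) (Fin l) ℂ) :
    ∫ ω, V * f ω ∂P = V * ∫ ω, f ω ∂P :=
  integral_linearMap_comp hf (mulLeftLinearMap (Fin m) ℝ V)

lemma integrable_mul_mul {Ω : Type*} [MeasurableSpace Ω] {P : Measure Ω} {k : ℕ}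
    {f : Ω → Matrix (Fin l) (Fin m) ℂ} (hf : Integrable f P) (V : Matrix (Fin k) (Fin l) ℂ)
    (R : Matrix (Fin m) (Fin n) ℂ) :
    Integrable (fun ω => V * f ω * R) P :=
  integrable_mul_const (integrable_const_mul hf V) R

lemma integrable_conjTranspose {Ω : Type*} [MeasurableSpace Ω] {P : Measure Ω}
    {f : Ω → Matrix (Fin l) (Fin m) ℂ} (hf : Integrable f P) :
    Integrable (fun ω => (f ω)ᴴ) P :=
  (LinearMap.toContinuousLinearMap
    (Matrix.conjTransposeLinearEquiv (Fin l) (Fin m) ℝ ℂ).toLinearMap).integrable_comp hf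

/-- Links the entrywise expectation to the Bochner integral, which commutes with products by fixed
matrices. -/
lemma expOuter_eq_integral {Ω : Type*} [MeasurableSpace Ω] {P : Measure Ω}
    {g : Ω → CVec m} {h : Ω → CVec n} (hgh : Integrable (fun ω => outer (g ω) (h ω)) P) :
    expOuter P g h = ∫ ω, outer (g ω) (h ω) ∂P := by
  ext i k
  exact integral_linearMap_comp hgh (Matrix.entryLinearMap ℝ ℂ i k)

lemma expOuter_comp {Ω : Type*} [MeasurableSpace Ω] {P : Measure Ω} {k : ℕ}
    {Y : Ω → CVec k} {θ : Measure (CVec k)} (hY : HasLaw Y θ P) {g : CVec k → CVec m}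
    {h : CVec k → CVec n} (hg : Measurable g) (hh : Measurable h) :
    expOuter P (fun ω => g (Y ω)) (fun ω => h (Y ω)) = expOuter θ g h := by
  ext i j
  simp only [expOuter, Matrix.of_apply]
  rw [← hY.map_eq, integral_map hY.aemeasurable]
  refine Measurable.aestronglyMeasurable ?_
  simp only [outer, Matrix.vecMulVec_apply, Pi.star_apply]
  fun_prop

end Outer

/-! ### Hilbert–Schmidt Pythagoras for the projections `P` and `Q`. -/

section Frobenius

variable {m n : ℕ}

lemma frobenius_norm_sq_eq_re_trace (X : Matrix (Fin m) (Fin n) ℂ) :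
    ‖X‖ ^ 2 = (Matrix.trace (Xᴴ * X)).re := by
  rw [Matrix.frobenius_norm_def, ← Real.sqrt_eq_rpow, Real.sq_sqrt (by positivity),
    Finset.sum_comm]
  simp [Matrix.trace, Matrix.mul_apply, Matrix.conjTranspose_apply, ← Complex.normSq_eq_norm_sq,
    Complex.normSq_apply]

end Frobenius

section Projection

variable {n r : ℕ} {U : Matrix (Fin n) (Fin r) ℂ}

lemma projP_add_projQ : projP U + projQ U = 1 := by simp [projQ]

lemma conjTranspose_projP : (projP U)ᴴ = projP U := by simp [projP]

lemma conjTranspose_projQ : (projQ U)ᴴ = projQ U := by simp [projQ, conjTranspose_projP]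

variable (hU : U ∈ stiefel n r)
include hU

lemma projQ_mul : projQ U * U = 0 := by
  have h : Uᴴ * U = 1 := hU
  simp [projQ, projP, Matrix.sub_mul, Matrix.mul_assoc, h]

lemma conjTranspose_mul_projQ : Uᴴ * projQ U = 0 := by
  simpa [conjTranspose_projQ] using congrArg Matrix.conjTranspose (projQ_mul hU)

lemma projP_mul_projP : projP U * projP U = projP U := by
  have h : Uᴴ * U = 1 := hU
  simp only [projP, Matrix.mul_assoc]
  rw [← Matrix.mul_assoc Uᴴ, h, Matrix.one_mul]

lemma projQ_mul_projQ : projQ U * projQ U = projQ U := by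
  simp [projQ, Matrix.sub_mul, Matrix.mul_sub, projP_mul_projP hU]

/-- `P` and `Q` are Hermitian idempotents with sum `1`, so `tr X†X = tr X†P†PX + tr X†Q†QX`. -/
lemma norm_sq_eq_left (X : Matrix (Fin n) (Fin n) ℂ) :
    ‖X‖ ^ 2 = ‖projP U * X‖ ^ 2 + ‖projQ U * X‖ ^ 2 := by
  simp only [frobenius_norm_sq_eq_re_trace, ← Complex.add_re, ← Matrix.trace_add]
  congr 2
  simp only [Matrix.conjTranspose_mul, conjTranspose_projP, conjTranspose_projQ]
  rw [Matrix.mul_assoc Xᴴ, Matrix.mul_assoc Xᴴ, ← Matrix.mul_assoc (projP U),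
    ← Matrix.mul_assoc (projQ U), projP_mul_projP hU, projQ_mul_projQ hU, ← Matrix.mul_add,
    ← Matrix.add_mul, projP_add_projQ, Matrix.one_mul]

lemma norm_sq_eq_right (X : Matrix (Fin n) (Fin n) ℂ) :
    ‖X‖ ^ 2 = ‖X * projP U‖ ^ 2 + ‖X * projQ U‖ ^ 2 := by
  have h := norm_sq_eq_left hU Xᴴ
  rw [← Matrix.frobenius_norm_conjTranspose (projP U * Xᴴ),
    ← Matrix.frobenius_norm_conjTranspose (projQ U * Xᴴ)] at h
  simpa [conjTranspose_projP, conjTranspose_projQ, Matrix.frobenius_norm_conjTranspose] using h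

/-- Source of both optimality and uniqueness: the first term is common to all competitors, the
second measures the error in `G`. -/
lemma norm_sq_projQ_le (X : Matrix (Fin n) (Fin n) ℂ) :
    ‖projQ U * X * projQ U‖ ^ 2 + ‖projQ U * X * projP U‖ ^ 2 ≤ ‖X‖ ^ 2 := by
  rw [norm_sq_eq_left hU X, norm_sq_eq_right hU (projQ U * X)]
  nlinarith [sq_nonneg ‖projP U * X‖]

end Projection

end SDLR

namespace SDLR

/-! ### Gauged generators: Hermitian matrices that are off-diagonal with respect to `Ran U`. -/

section Gauge

variable {n r : ℕ} {U : Matrix (Fin n) (Fin r) ℂ} (hU : U ∈ stiefel n r)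
include hU

lemma IsGauge.conjTranspose_mul_mul {G : Matrix (Fin n) (Fin n) ℂ} (hG : IsGauge U G) :
    Uᴴ * G * U = 0 := by
  have hl := conjTranspose_mul_projQ hU
  have hr := projQ_mul hU
  rw [hG.2]
  simp only [Matrix.conjTranspose_mul, conjTranspose_projQ, Matrix.mul_add, Matrix.add_mul,
    Matrix.mul_assoc, hr, Matrix.mul_zero, add_zero]
  simp only [← Matrix.mul_assoc, hl, Matrix.zero_mul]

omit hU in
-- `QGP = (QGU)U†`, and the gauge condition recovers `G` from `QGP`.
lemma IsGauge.eq_of_projQ_mul_mul {G G' : Matrix (Fin n) (Fin n) ℂ} (hG : IsGauge U G)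
    (hG' : IsGauge U G') (h : projQ U * G * U = projQ U * G' * U) : G = G' := by
  rw [hG.2, hG'.2]
  simp only [projP, ← Matrix.mul_assoc, h]

/-- Compressing by `Q` on the left and `P` on the right keeps `QZU†` and kills its adjoint, since
`QU = 0`. -/
lemma isGauge_add_conjTranspose (c : ℂ) (Z : Matrix (Fin n) (Fin r) ℂ) :
    IsGauge U (c • (projQ U * Z * Uᴴ) + (c • (projQ U * Z * Uᴴ))ᴴ) := by
  have h : Uᴴ * U = 1 := hU
  refine ⟨by simp [add_comm], ?_⟩
  have hK : projQ U * (c • (projQ U * Z * Uᴴ) + (c • (projQ U * Z * Uᴴ))ᴴ) * projP U =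
      c • (projQ U * Z * Uᴴ) := by
    simp only [projP, Matrix.conjTranspose_smul, Matrix.conjTranspose_mul,
      Matrix.conjTranspose_conjTranspose, Matrix.mul_add, Matrix.mul_smul,
      Matrix.smul_mul, ← Matrix.mul_assoc, projQ_mul_projQ hU, projQ_mul hU, Matrix.zero_mul,
      smul_zero, add_zero]
    rw [Matrix.mul_assoc _ Uᴴ U, h, Matrix.mul_one]
  rw [hK]

lemma add_conjTranspose_mul (c : ℂ) (Z : Matrix (Fin n) (Fin r) ℂ) :
    (c • (projQ U * Z * Uᴴ) + (c • (projQ U * Z * Uᴴ))ᴴ) * U = c • (projQ U * Z) := by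
  have h : Uᴴ * U = 1 := hU
  simp only [Matrix.conjTranspose_smul, Matrix.conjTranspose_mul, conjTranspose_projQ,
    Matrix.conjTranspose_conjTranspose, Matrix.add_mul, Matrix.smul_mul, Matrix.mul_assoc,
    projQ_mul hU, Matrix.mul_zero, smul_zero, add_zero, h, Matrix.mul_one]

end Gauge

/-! ### Pulling pairings with the low-rank measure back to `θ`. -/

section LowRankPairing

variable {n r N : ℕ} {F : Type*} [NormedAddCommGroup F] [NormedSpace ℝ F]
  {a : CVec n → CVec n} {b : Fin N → CVec n → CVec n} {U : Matrix (Fin n) (Fin r) ℂ}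
  {θ : Measure (CVec r)} {f : CVec n → F}

lemma measurable_mulVec {m n : ℕ} (V : Matrix (Fin m) (Fin n) ℂ) :
    Measurable (fun y : CVec n => V *ᵥ y) := by
  refine Continuous.measurable ?_
  fun_prop

lemma pairingExists_lowRankMeasure_iff
    (hm : AEStronglyMeasurable (generator a b f) (lowRankMeasure U θ)) :
    PairingExists a b (lowRankMeasure U θ) f ↔
      Integrable (fun y => generator a b f (U *ᵥ y)) θ :=
  integrable_map_measure hm (measurable_mulVec U).aemeasurable

lemma fokkerPlanck_lowRankMeasure (h : PairingExists a b (lowRankMeasure U θ) f) :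
    fokkerPlanck a b (lowRankMeasure U θ) f = ∫ y, generator a b f (U *ᵥ y) ∂θ :=
  integral_map (measurable_mulVec U).aemeasurable h.aestronglyMeasurable

end LowRankPairing

/-! ### Blocks of the generator on `Ran U`, and admissibility of the explicit choice. -/

section SquareFun

attribute [local instance] frobeniusTopology

variable {n r N : ℕ} {a : CVec n → CVec n} {b : Fin N → CVec n → CVec n}
  {U : Matrix (Fin n) (Fin r) ℂ} {θ : Measure (CVec r)}

lemma aestronglyMeasurable_generator_squareFun (ha : Measurable a) (hb : ∀ j, Measurable (b j))
    (μ : Measure (CVec n)) : AEStronglyMeasurable (generator a b (squareFun n)) μ := by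
  rw [show generator a b (squareFun n) = _ from funext (generator_squareFun a b)]
  exact ((aestronglyMeasurable_outer ha.aestronglyMeasurable aestronglyMeasurable_id).add
    (aestronglyMeasurable_outer aestronglyMeasurable_id ha.aestronglyMeasurable)).add
    (Finset.univ.aestronglyMeasurable_fun_sum fun j _ =>
      aestronglyMeasurable_outer (hb j).aestronglyMeasurable (hb j).aestronglyMeasurable)

lemma conjTranspose_generator_squareFun (x : CVec n) :
    (generator a b (squareFun n) x)ᴴ = generator a b (squareFun n) x := by
  simp only [generator_squareFun, Matrix.conjTranspose_add, Matrix.conjTranspose_sum,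
    conjTranspose_outer]
  rw [add_comm (outer x (a x))]

lemma integrable_generator_squareFun
    (hay : Integrable (fun y => outer (a (U *ᵥ y)) y) θ)
    (hbb : ∀ j, Integrable (fun y => outer (b j (U *ᵥ y)) (b j (U *ᵥ y))) θ) :
    Integrable (fun y => generator a b (squareFun n) (U *ᵥ y)) θ := by
  have h : Integrable (fun y => outer (a (U *ᵥ y)) (U *ᵥ y)) θ := by
    simp only [outer_mulVec_right]
    exact integrable_mul_const hay Uᴴ
  have h' := integrable_conjTranspose h
  simp only [conjTranspose_outer] at h'
  simp only [generator_squareFun]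
  exact (h.add h').add (integrable_finsetSum _ fun j _ => hbb j)

section Pointwise

variable (hU : U ∈ stiefel n r)
include hU

/-- Each drift term has the factor `x = Uy` on one side, where `Q` annihilates it. -/
lemma projQ_mul_generator_mul_projQ (y : CVec r) :
    projQ U * generator a b (squareFun n) (U *ᵥ y) * projQ U =
      ∑ j, projQ U * outer (b j (U *ᵥ y)) (b j (U *ᵥ y)) * projQ U := by
  rw [generator_squareFun, outer_mulVec_right, outer_mulVec_left]
  simp only [Matrix.mul_add, Matrix.add_mul, Matrix.mul_sum, Matrix.sum_mul]
  rw [Matrix.mul_assoc, Matrix.mul_assoc _ Uᴴ, conjTranspose_mul_projQ hU, ← Matrix.mul_assoc,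
    ← Matrix.mul_assoc, projQ_mul hU]
  simp

lemma projQ_mul_generator_mul (y : CVec r) :
    projQ U * generator a b (squareFun n) (U *ᵥ y) * U =
      projQ U * outer (a (U *ᵥ y)) y +
        ∑ j, projQ U * outer (b j (U *ᵥ y)) (b j (U *ᵥ y)) * U := by
  have h : Uᴴ * U = 1 := hU
  rw [generator_squareFun, outer_mulVec_right, outer_mulVec_left]
  simp only [Matrix.mul_add, Matrix.add_mul, Matrix.mul_sum, Matrix.sum_mul]
  rw [Matrix.mul_assoc, Matrix.mul_assoc _ Uᴴ, h, Matrix.mul_one, ← Matrix.mul_assoc (projQ U) U,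
    projQ_mul hU]
  simp

variable (p : Params n r)

lemma projQ_mul_generator_lowRank_mul_projQ (y : CVec r) :
    projQ U * generator (p.aLR U) (p.bLR U) (squareFun n) (U *ᵥ y) * projQ U = 0 := by
  rw [projQ_mul_generator_mul_projQ hU]
  refine Finset.sum_eq_zero fun j _ => ?_
  rw [Params.bLR, outer_mulVec_left, ← Matrix.mul_assoc, projQ_mul hU, Matrix.zero_mul,
    Matrix.zero_mul]

/-- The contributions of `A` and `B` are in `Ran U` and die under `Q`; only the rotation `iGx` moves
mass out of `Ran U`. -/
lemma projQ_mul_generator_lowRank_mul (y : CVec r) :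
    projQ U * generator (p.aLR U) (p.bLR U) (squareFun n) (U *ᵥ y) * U =
      Complex.I • (projQ U * p.G * U) * outer y y := by
  rw [projQ_mul_generator_mul hU, Finset.sum_eq_zero, add_zero, Params.aLR, outer_add_left,
    outer_smul_left, outer_mulVec_left, outer_mulVec_left, outer_mulVec_left, Matrix.mul_add,
    ← Matrix.mul_assoc (projQ U) U, projQ_mul hU]
  · simp [Matrix.mul_assoc]
  · intro j _
    rw [Params.bLR, outer_mulVec_left, ← Matrix.mul_assoc, projQ_mul hU, Matrix.zero_mul,
      Matrix.zero_mul]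

lemma conjTranspose_mul_generator_mul (y : CVec r) :
    Uᴴ * generator a b (squareFun n) (U *ᵥ y) * U =
      outer (Uᴴ *ᵥ a (U *ᵥ y)) y + outer y (Uᴴ *ᵥ a (U *ᵥ y)) +
        ∑ j, outer (Uᴴ *ᵥ b j (U *ᵥ y)) (Uᴴ *ᵥ b j (U *ᵥ y)) := by
  have h : Uᴴ * U = 1 := hU
  have ho : ∀ u v : CVec n, Uᴴ * outer u v * U = outer (Uᴴ *ᵥ u) (Uᴴ *ᵥ v) := fun u v => by
    rw [outer_mulVec_left, outer_mulVec_right, Matrix.conjTranspose_conjTranspose,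
      Matrix.mul_assoc]
  rw [generator_squareFun]
  simp only [Matrix.mul_add, Matrix.add_mul, Matrix.mul_sum, Matrix.sum_mul, ho]
  simp [h]

lemma isGauge_optG : IsGauge U (optG a b U θ) := by
  unfold optG
  simp only [Matrix.mul_assoc]
  simpa only [Matrix.mul_assoc] using isGauge_add_conjTranspose hU (-Complex.I)
    ((expOuter θ (fun y => a (U *ᵥ y)) (fun y => U *ᵥ y) +
      ∑ j, expOuter θ (fun y => b j (U *ᵥ y)) (fun y => b j (U *ᵥ y))) *
    U * (expOuter θ (fun y => y) (fun y => y))⁻¹)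

lemma optG_mul : optG a b U θ * U = (-Complex.I) • (projQ U *
    ((expOuter θ (fun y => a (U *ᵥ y)) (fun y => U *ᵥ y) +
      ∑ j, expOuter θ (fun y => b j (U *ᵥ y)) (fun y => b j (U *ᵥ y))) *
    U * (expOuter θ (fun y => y) (fun y => y))⁻¹)) := by
  rw [← add_conjTranspose_mul hU]
  simp only [optG, Matrix.mul_assoc]

lemma aLR_optParams (y : CVec r) :
    (optParams a b U θ).aLR U (U *ᵥ y) =
      Complex.I • ((optG a b U θ * U) *ᵥ y) + (U * Uᴴ) *ᵥ a (U *ᵥ y) := by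
  have h : Uᴴ * U = 1 := hU
  simp [Params.aLR, optParams, h]

lemma bLR_optParams (y : CVec r) (j : Fin N) :
    (optParams a b U θ).bLR U j (U *ᵥ y) = (U * Uᴴ) *ᵥ b j (U *ᵥ y) := by
  have h : Uᴴ * U = 1 := hU
  simp [Params.bLR, optParams, h]

/-- Compression by `U†` and `U` sees only `U†a` and `U†bⱼ`. The explicit choice preserves these, and
its rotation is invisible because `U†GU = 0`. -/
lemma conjTranspose_mul_generator_optParams_mul (y : CVec r) :
    Uᴴ * generator ((optParams a b U θ).aLR U) ((optParams a b U θ).bLR U) (squareFun n)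
        (U *ᵥ y) * U =
      Uᴴ * generator a b (squareFun n) (U *ᵥ y) * U := by
  have h : Uᴴ * U = 1 := hU
  have ha : Uᴴ *ᵥ (optParams a b U θ).aLR U (U *ᵥ y) = Uᴴ *ᵥ a (U *ᵥ y) := by
    rw [aLR_optParams hU, Matrix.mulVec_add, Matrix.mulVec_smul, Matrix.mulVec_mulVec,
      Matrix.mulVec_mulVec, ← Matrix.mul_assoc, ← Matrix.mul_assoc, h, Matrix.one_mul,
      (isGauge_optG hU).conjTranspose_mul_mul hU]
    simp
  have hb : ∀ j : Fin N, Uᴴ *ᵥ (optParams a b U θ).bLR U j (U *ᵥ y) = Uᴴ *ᵥ b j (U *ᵥ y) := fun j =>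
    (congrArg (Uᴴ *ᵥ ·) (bLR_optParams hU y j)).trans (by
      simp only [Matrix.mulVec_mulVec, ← Matrix.mul_assoc, h, Matrix.one_mul])
  rw [conjTranspose_mul_generator_mul hU, conjTranspose_mul_generator_mul hU, ha]
  congr 1
  exact Finset.sum_congr rfl fun j _ => congrArg₂ outer (hb j) (hb j)

end Pointwise

lemma Params.integrable_generator {p : Params n r} (hp : p.Admissible U θ) :
    Integrable (fun y => generator (p.aLR U) (p.bLR U) (squareFun n) (U *ᵥ y)) θ :=
  (pairingExists_lowRankMeasure_iff hp.integrable.aestronglyMeasurable).1 hp.integrable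

/-- The difference `∫ f d(𝒜_LR μ_LR) - ∫ f d(𝒜 μ_LR)` for `f(x) = x x†`. -/
noncomputable def Params.defect (p : Params n r) (a : CVec n → CVec n)
    (b : Fin N → CVec n → CVec n) (U : Matrix (Fin n) (Fin r) ℂ) (θ : Measure (CVec r)) :
    Matrix (Fin n) (Fin n) ℂ :=
  (∫ y, generator (p.aLR U) (p.bLR U) (squareFun n) (U *ᵥ y) ∂θ) -
    ∫ y, generator a b (squareFun n) (U *ᵥ y) ∂θ

lemma Params.residual_eq {p : Params n r} (hp : p.Admissible U θ)
    (hab : PairingExists a b (lowRankMeasure U θ) (squareFun n)) :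
    p.residual a b U θ = ‖p.defect a b U θ‖ₑ := by
  simp only [Params.residual, dTest, Set.mem_singleton_iff, iSup_iSup_eq_left,
    fokkerPlanck_lowRankMeasure hab, fokkerPlanck_lowRankMeasure hp.integrable, Params.defect]

/-- On `Ran U` the new coefficients are `iGUy + P a(Uy)` and `P bⱼ(Uy)`, so their second-order
expressions are fixed matrix multiples of integrable ones. -/
lemma admissible_optParams (hU : U ∈ stiefel n r) (ha : Measurable a) (hb : ∀ j, Measurable (b j))
    (hyy : Integrable (fun y => outer y y) θ)
    (hay : Integrable (fun y => outer (a (U *ᵥ y)) y) θ)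
    (hbb : ∀ j, Integrable (fun y => outer (b j (U *ᵥ y)) (b j (U *ᵥ y))) θ) :
    (optParams a b U θ).Admissible U θ := by
  have hA : Measurable (optParams a b U θ).A :=
    (measurable_mulVec Uᴴ).comp (ha.comp (measurable_mulVec U))
  have hB : ∀ j, Measurable ((optParams a b U θ).B j) := fun j =>
    (measurable_mulVec Uᴴ).comp ((hb j).comp (measurable_mulVec U))
  refine ⟨hA, hB, isGauge_optG hU, ?_⟩
  have hm : Measurable ((optParams a b U θ).aLR U) :=
    ((measurable_mulVec _).const_smul Complex.I).add
      ((measurable_mulVec U).comp (hA.comp (measurable_mulVec Uᴴ)))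
  have hm' : ∀ j, Measurable ((optParams a b U θ).bLR U j) := fun j =>
    (measurable_mulVec U).comp ((hB j).comp (measurable_mulVec Uᴴ))
  rw [pairingExists_lowRankMeasure_iff (aestronglyMeasurable_generator_squareFun hm hm' _)]
  refine integrable_generator_squareFun ?_ fun j => ?_
  · simp only [aLR_optParams hU, outer_add_left, outer_smul_left, outer_mulVec_left]
    refine .add ?_ ?_
    · exact (integrable_const_mul hyy (optG a b U θ * U)).smul Complex.I
    · exact integrable_const_mul hay (U * Uᴴ)
  · have h : (fun y => outer ((optParams a b U θ).bLR U j (U *ᵥ y))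
        ((optParams a b U θ).bLR U j (U *ᵥ y))) = fun y =>
        (U * Uᴴ) * outer (b j (U *ᵥ y)) (b j (U *ᵥ y)) * (U * Uᴴ)ᴴ := funext fun y => by
      rw [← outer_mulVec_left, ← outer_mulVec_right]
      exact congrArg₂ outer (bLR_optParams hU y j) (bLR_optParams hU y j)
    rw [h]
    exact integrable_mul_mul (hbb j) _ _

/-! ### Blocks of the averaged defect; optimality and uniqueness. -/

section Defect

variable (hU : U ∈ stiefel n r)
  (hay : Integrable (fun y => outer (a (U *ᵥ y)) y) θ)
  (hbb : ∀ j, Integrable (fun y => outer (b j (U *ᵥ y)) (b j (U *ᵥ y))) θ)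
include hU hay hbb

lemma projQ_mul_defect_mul_projQ {p : Params n r} (hp : p.Admissible U θ) :
    projQ U * p.defect a b U θ * projQ U =
      -∑ j, projQ U * expOuter θ (fun y => b j (U *ᵥ y)) (fun y => b j (U *ᵥ y)) * projQ U := by
  rw [Params.defect, Matrix.mul_sub, Matrix.sub_mul,
    ← integral_mul_mul (Params.integrable_generator hp),
    ← integral_mul_mul (integrable_generator_squareFun hay hbb)]
  simp only [projQ_mul_generator_lowRank_mul_projQ hU, projQ_mul_generator_mul_projQ hU]
  rw [integral_finsetSum _ fun j _ => integrable_mul_mul (hbb j) _ _]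
  simp only [integral_mul_mul (hbb _), expOuter_eq_integral (hbb _), integral_zero, zero_sub]

lemma projQ_mul_defect_mul (hyy : Integrable (fun y => outer y y) θ) {p : Params n r}
    (hp : p.Admissible U θ) :
    projQ U * p.defect a b U θ * U =
      Complex.I • (projQ U * p.G * U) * expOuter θ (fun y => y) (fun y => y) -
      projQ U * (expOuter θ (fun y => a (U *ᵥ y)) (fun y => U *ᵥ y) +
        ∑ j, expOuter θ (fun y => b j (U *ᵥ y)) (fun y => b j (U *ᵥ y))) * U := by
  have h : Uᴴ * U = 1 := hU
  have hay' : Integrable (fun y => outer (a (U *ᵥ y)) (U *ᵥ y)) θ := by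
    simp only [outer_mulVec_right]
    exact integrable_mul_const hay Uᴴ
  -- Inserting `U†U = 1` turns `a y†` into `a (Uy)† U`, the form in which the drift expectation
  -- enters `optG`.
  have hterm : ∀ y, projQ U * outer (a (U *ᵥ y)) y =
      projQ U * outer (a (U *ᵥ y)) (U *ᵥ y) * U := fun y => by
    rw [outer_mulVec_right, Matrix.mul_assoc, Matrix.mul_assoc, h, Matrix.mul_one]
  rw [Params.defect, Matrix.mul_sub, Matrix.sub_mul,
    ← integral_mul_mul (Params.integrable_generator hp),
    ← integral_mul_mul (integrable_generator_squareFun hay hbb)]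
  simp only [projQ_mul_generator_lowRank_mul hU, projQ_mul_generator_mul hU, hterm]
  rw [integral_add (integrable_mul_mul hay' _ _)
      (integrable_finsetSum _ fun j _ => integrable_mul_mul (hbb j) _ _),
    integral_finsetSum _ fun j _ => integrable_mul_mul (hbb j) _ _]
  simp only [integral_mul_mul (hbb _), expOuter_eq_integral (hbb _), integral_mul_mul hay',
    expOuter_eq_integral hay', integral_const_mul hyy, expOuter_eq_integral hyy,
    Matrix.mul_add, Matrix.add_mul, Matrix.mul_sum, Matrix.sum_mul]

variable (hyy : Integrable (fun y => outer y y) θ)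
  (hinv : IsUnit (expOuter θ (fun y => y) (fun y => y)))
include hyy hinv

/-- The factor `-i · E[yy†]⁻¹` in `optG` cancels the `i` and the `E[yy†]` of the `G`-term. -/
lemma projQ_mul_defect_optParams_mul (hp : (optParams a b U θ).Admissible U θ) :
    projQ U * (optParams a b U θ).defect a b U θ * U = 0 := by
  have hdet := (Matrix.isUnit_iff_isUnit_det _).1 hinv
  rw [projQ_mul_defect_mul hU hay hbb hyy hp, sub_eq_zero,
    show (optParams a b U θ).G = optG a b U θ from rfl, Matrix.mul_assoc (projQ U), optG_mul hU]
  simp only [Matrix.mul_smul, smul_smul, ← Matrix.mul_assoc, projQ_mul_projQ hU, Matrix.smul_mul]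
  rw [Matrix.mul_assoc _ _⁻¹, Matrix.nonsing_inv_mul _ hdet]
  simp

lemma defect_optParams (hp : (optParams a b U θ).Admissible U θ) :
    (optParams a b U θ).defect a b U θ =
      -∑ j, projQ U * expOuter θ (fun y => b j (U *ᵥ y)) (fun y => b j (U *ᵥ y)) * projQ U := by
  set D := (optParams a b U θ).defect a b U θ with hD
  have hQU : projQ U * D * U = 0 := projQ_mul_defect_optParams_mul hU hay hbb hyy hinv hp
  have hI := Params.integrable_generator hp
  have hI' := integrable_generator_squareFun hay hbb
  -- Self-adjointness yields the second off-diagonal block from the first.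
  have hDD : Dᴴ = D := by
    rw [hD, Params.defect, Matrix.conjTranspose_sub, ← integral_conjTranspose hI,
      ← integral_conjTranspose hI']
    simp only [conjTranspose_generator_squareFun]
  have hUQ : Uᴴ * D * projQ U = 0 := by
    simpa [conjTranspose_projQ, hDD, Matrix.mul_assoc] using congrArg Matrix.conjTranspose hQU
  have hUU : Uᴴ * D * U = 0 := by
    rw [hD, Params.defect, Matrix.mul_sub, Matrix.sub_mul, ← integral_mul_mul hI,
      ← integral_mul_mul hI', sub_eq_zero]
    simp only [conjTranspose_mul_generator_optParams_mul hU]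
  rw [← projQ_mul_defect_mul_projQ hU hay hbb hp, ← hD]
  have hPQ : projP U * D * projQ U = 0 := by
    rw [projP, Matrix.mul_assoc U, Matrix.mul_assoc U, hUQ, Matrix.mul_zero]
  have hP : D * projP U = 0 := by
    have hUP : D * U = 0 := by
      calc D * U = (projP U + projQ U) * D * U := by rw [projP_add_projQ, Matrix.one_mul]
        _ = U * (Uᴴ * D * U) + projQ U * D * U := by
          simp only [projP, Matrix.add_mul, Matrix.mul_assoc]
        _ = 0 := by rw [hUU, hQU, Matrix.mul_zero, add_zero]
    rw [projP, ← Matrix.mul_assoc, hUP, Matrix.zero_mul]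
  calc D = (projP U + projQ U) * D * (projP U + projQ U) := by
        rw [projP_add_projQ, Matrix.one_mul, Matrix.mul_one]
    _ = projQ U * D * projQ U := by
        rw [Matrix.mul_add, Matrix.mul_assoc _ D, hP, Matrix.mul_zero, zero_add, Matrix.add_mul,
          Matrix.add_mul, hPQ, zero_add]

lemma defect_optParams_eq {p : Params n r} (hopt : (optParams a b U θ).Admissible U θ)
    (hp : p.Admissible U θ) :
    (optParams a b U θ).defect a b U θ = projQ U * p.defect a b U θ * projQ U := by
  rw [defect_optParams hU hay hbb hyy hinv hopt, projQ_mul_defect_mul_projQ hU hay hbb hp]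

lemma norm_defect_optParams_le {p : Params n r} (hopt : (optParams a b U θ).Admissible U θ)
    (hp : p.Admissible U θ) :
    ‖(optParams a b U θ).defect a b U θ‖ ≤ ‖p.defect a b U θ‖ := by
  rw [defect_optParams_eq hU hay hbb hyy hinv hopt hp]
  refine le_of_sq_le_sq ?_ (norm_nonneg _)
  nlinarith [norm_sq_projQ_le hU (p.defect a b U θ),
    sq_nonneg ‖projQ U * p.defect a b U θ * projP U‖]

/-- With equal norms, Pythagoras leaves no room for `QDP`. Then `QDU` vanishes for both choices, so
`i QGU E[yy†]` agrees, and `E[yy†]` and `i` cancel. -/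
lemma eq_optG_of_norm_defect_eq {p : Params n r} (hopt : (optParams a b U θ).Admissible U θ)
    (hp : p.Admissible U θ)
    (h : ‖p.defect a b U θ‖ = ‖(optParams a b U θ).defect a b U θ‖) :
    p.G = optG a b U θ := by
  have hdet := (Matrix.isUnit_iff_isUnit_det _).1 hinv
  have hUU : Uᴴ * U = 1 := hU
  rw [defect_optParams_eq hU hay hbb hyy hinv hopt hp] at h
  have hle := norm_sq_projQ_le hU (p.defect a b U θ)
  rw [h] at hle
  have hz : projQ U * p.defect a b U θ * projP U = 0 := by
    rw [← norm_eq_zero]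
    exact pow_eq_zero_iff (two_ne_zero) |>.1 (le_antisymm (by linarith) (sq_nonneg _))
  have hz' : projQ U * p.defect a b U θ * U = 0 := by
    have := congrArg (· * U) hz
    simpa only [projP, Matrix.mul_assoc, hUU, Matrix.mul_one, Matrix.zero_mul] using this
  have hz'' := projQ_mul_defect_optParams_mul hU hay hbb hyy hinv hopt
  rw [projQ_mul_defect_mul hU hay hbb hyy hp, sub_eq_zero] at hz'
  rw [projQ_mul_defect_mul hU hay hbb hyy hopt, sub_eq_zero, ← hz'] at hz''
  refine hp.gauge.eq_of_projQ_mul_mul (isGauge_optG hU) ?_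
  have := congrArg (· * (expOuter θ (fun y => y) (fun y => y))⁻¹) hz''
  simp only [Matrix.mul_assoc _ _ (_⁻¹), Matrix.mul_nonsing_inv _ hdet, Matrix.mul_one] at this
  exact (smul_right_injective _ Complex.I_ne_zero this).symm

end Defect

end SquareFun

end SDLR

namespace SDLR

/-! ### Itô integrals and SDEs under a fixed linear map. -/

section LinearImage

variable {Ω : Type*} [mΩ : MeasurableSpace Ω] {d e N : ℕ} {𝓕 : Filtration ℝ mΩ} {P : Measure Ω}
  {T : ℝ}

/-- The image of a simple process under a continuous linear map. -/
noncomputable def SimpleProc.map (S : SimpleProc 𝓕 d) (L : CVec d →L[ℝ] CVec e) : SimpleProc 𝓕 e where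
  m := S.m
  τ := S.τ
  ξ := fun i ω => L (S.ξ i ω)
  nonneg := S.nonneg
  mono := S.mono
  measurable := fun i => L.continuous.comp_stronglyMeasurable (S.measurable i)
  bounded := by
    obtain ⟨C, hC⟩ := S.bounded
    exact ⟨‖L‖ * C, fun i ω => L.le_opNorm_of_le (hC i ω)⟩

lemma SimpleProc.eval_map (S : SimpleProc 𝓕 d) (L : CVec d →L[ℝ] CVec e) (t : ℝ) (ω : Ω) :
    (S.map L).eval t ω = L (S.eval t ω) := by
  simp only [SimpleProc.eval, SimpleProc.map, map_sum, Set.indicator_apply]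
  exact Finset.sum_congr rfl fun i _ => by split_ifs <;> simp

lemma SimpleProc.integral_map (S : SimpleProc 𝓕 d) (L : CVec d →L[ℝ] CVec e) (W : ℝ → Ω → ℝ)
    (t : ℝ) (ω : Ω) : (S.map L).integral W t ω = L (S.integral W t ω) := by
  simp [SimpleProc.integral, SimpleProc.map]

/-- `ε ≤ f` forces `ε / C ≤ g`. No separate case `C = 0` is needed, since `ε / 0 = ∞` is still
positive. -/
lemma tendsto_measure_le_of_le_mul {f g : ℕ → Ω → ℝ≥0∞} {C : ℝ≥0∞} (hC : C ≠ ∞)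
    (hfg : ∀ k ω, f k ω ≤ C * g k ω)
    (hg : ∀ ε : ℝ≥0∞, 0 < ε → Tendsto (fun k => P {ω | ε ≤ g k ω}) atTop (𝓝 0))
    {ε : ℝ≥0∞} (hε : 0 < ε) : Tendsto (fun k => P {ω | ε ≤ f k ω}) atTop (𝓝 0) := by
  refine tendsto_of_tendsto_of_tendsto_of_le_of_le tendsto_const_nhds
    (hg (ε / C) (ENNReal.div_pos hε.ne' hC)) (fun _ => zero_le) fun k => measure_mono fun ω hω => ?_
  exact ENNReal.div_le_of_le_mul' (le_trans hω (hfg k ω))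

/-- The images of the approximating simple processes approximate the image: errors grow at most by
`‖L‖²` in the integrands and by `‖L‖` in the integrals. -/
lemma IsItoIntegral.map {W : ℝ → Ω → ℝ} {H J : ℝ → Ω → CVec d} {H' : ℝ → Ω → CVec e}
    (h : IsItoIntegral 𝓕 P T W H J) (L : CVec d →L[ℝ] CVec e)
    (hH : ∀ s ∈ Set.Icc 0 T, ∀ ω, H' s ω = L (H s ω)) :
    IsItoIntegral 𝓕 P T W H' (fun t ω => L (J t ω)) := by
  obtain ⟨hc, S, hS, hJ⟩ := h
  refine ⟨hc.mono fun ω hω => L.continuous.comp_continuousOn hω, fun k => (S k).map L,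
    fun ε hε => ?_, fun t ht ε hε => ?_⟩
  · refine tendsto_measure_le_of_le_mul (C := ‖L‖ₑ ^ 2) (by finiteness) (fun k ω => ?_) hS hε
    rw [← lintegral_const_mul' _ _ (by finiteness)]
    refine setLIntegral_mono' measurableSet_Icc fun s hs => ?_
    rw [hH s hs, SimpleProc.eval_map, ← map_sub, ← mul_pow]
    gcongr
    exact L.le_opENorm _
  · refine tendsto_measure_le_of_le_mul (C := ‖L‖ₑ) (by finiteness) (fun k ω => ?_) (hJ t ht) hε
    simp only [SimpleProc.integral_map]
    exact L.lipschitz _ _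

/-- `L` does not depend on time, so no product rule is involved; the coefficients need only be
intertwined by `L` on `[0, T]`. -/
lemma SolvesSDE.map {W : Fin N → ℝ → Ω → ℝ} {A : ℝ → CVec d → CVec d}
    {B : Fin N → ℝ → CVec d → CVec d} {Y : ℝ → Ω → CVec d} {A' : ℝ → CVec e → CVec e}
    {B' : Fin N → ℝ → CVec e → CVec e} {X : ℝ → Ω → CVec e} (hT : 0 ≤ T)
    (h : SolvesSDE 𝓕 P T W A B Y) (L : CVec d →L[ℝ] CVec e)
    (hX : ∀ t ∈ Set.Icc 0 T, ∀ ω, X t ω = L (Y t ω))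
    (hA : ∀ t ∈ Set.Icc 0 T, ∀ y, A' t (L y) = L (A t y))
    (hB : ∀ j, ∀ t ∈ Set.Icc 0 T, ∀ y, B' j t (L y) = L (B j t y)) :
    SolvesSDE 𝓕 P T W A' B' X := by
  have hAX : ∀ ω, Set.EqOn (fun s => A' s (X s ω)) (fun s => L (A s (Y s ω))) (Set.Icc 0 T) :=
    fun ω s hs => by simp only [hX s hs, hA s hs]
  refine ⟨fun t ht => ?_, h.continuous.mono fun ω hω => ?_, h.integrable.mono fun ω hω => ?_, ?_⟩
  · rw [show X t = fun ω => L (Y t ω) from funext (hX t ht)]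
    exact L.continuous.comp_stronglyMeasurable (h.adapted t ht)
  · exact (L.continuous.comp_continuousOn hω).congr fun t ht => hX t ht ω
  · exact (integrableOn_congr_fun (hAX ω) measurableSet_Icc).2 (L.integrable_comp hω)
  · obtain ⟨J, hJ, hY⟩ := h.equation
    refine ⟨fun j t ω => L (J j t ω), fun j => (hJ j).map L fun s hs ω => ?_, ?_⟩
    · rw [hX s hs, hB j s hs]
    · filter_upwards [hY, h.integrable] with ω hω hint t ht
      have hsub : Set.uIcc 0 t ⊆ Set.Icc 0 T := by
        rw [Set.uIcc_of_le ht.1]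
        exact Set.Icc_subset_Icc_right ht.2
      have hi : IntervalIntegrable (fun s => A s (Y s ω)) volume 0 t :=
        (hint.mono_set hsub).intervalIntegrable
      rw [intervalIntegral.integral_congr ((hAX ω).mono hsub),
        L.intervalIntegral_comp_comm hi, hX t ht, hX 0 ⟨le_rfl, hT⟩, hω t ht]
      simp

end LinearImage

/-- Multiplication by a complex matrix as a continuous real linear map. -/
noncomputable def mulVecCLM {d e : ℕ} (V : Matrix (Fin e) (Fin d) ℂ) : CVec d →L[ℝ] CVec e :=
  LinearMap.toContinuousLinearMap ((Matrix.mulVecLin V).restrictScalars ℝ)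

@[simp] lemma mulVecCLM_apply {d e : ℕ} (V : Matrix (Fin e) (Fin d) ℂ) (y : CVec d) :
    mulVecCLM V y = V *ᵥ y := rfl

lemma eq_of_hasDerivWithinAt_zero {E : Type*} [NormedAddCommGroup E] [NormedSpace ℝ E] {T : ℝ}
    {f : ℝ → E} (hf : ∀ t ∈ Set.Icc 0 T, HasDerivWithinAt f 0 (Set.Icc 0 T) t) :
    ∀ t ∈ Set.Icc 0 T, f t = f 0 :=
  constant_of_has_deriv_right_zero (fun t ht => (hf t ht).continuousWithinAt) fun t ht =>
    (hf t (Set.Ico_subset_Icc_self ht)).mono_of_mem_nhdsWithin (Icc_mem_nhdsGE_of_mem ht)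

lemma SolvesFokkerPlanck.congr {n N : ℕ} {T : ℝ} {a a' : ℝ → CVec n → CVec n}
    {b b' : Fin N → ℝ → CVec n → CVec n} {μ : ℝ → Measure (CVec n)}
    (h : SolvesFokkerPlanck T a b μ) (ha : ∀ t ∈ Set.Icc 0 T, a t = a' t)
    (hb : ∀ j, ∀ t ∈ Set.Icc 0 T, b j t = b' j t) : SolvesFokkerPlanck T a' b' μ := by
  refine ⟨h.1, fun φ hφ hφc t ht => ?_⟩
  have hb' : (fun j => b j t) = fun j => b' j t := funext fun j => hb j t ht
  rw [← ha t ht, ← hb']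
  exact h.2 φ hφ hφc t ht

/-! ### Full rank: a square isometry is unitary, so the projections are trivial. -/

section FullRank

variable {n N : ℕ} {U : Matrix (Fin n) (Fin n) ℂ}

lemma projP_of_square (hU : U ∈ stiefel n n) : projP U = 1 :=
  mul_eq_one_comm.1 hU

lemma projQ_of_square (hU : U ∈ stiefel n n) : projQ U = 0 := by
  rw [projQ, projP_of_square hU, sub_self]

variable {a : CVec n → CVec n} {b : Fin N → CVec n → CVec n} {θ : Measure (CVec n)}

lemma aLR_optParams_of_square (hU : U ∈ stiefel n n) : (optParams a b U θ).aLR U = a := by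
  have h : U * Uᴴ = 1 := projP_of_square hU
  ext1 x
  simp [Params.aLR, optParams, optG, projQ_of_square hU, h]

lemma bLR_optParams_of_square (hU : U ∈ stiefel n n) (j : Fin N) :
    (optParams a b U θ).bLR U j = b j := by
  have h : U * Uᴴ = 1 := projP_of_square hU
  ext1 x
  simp [Params.bLR, optParams, h]

end FullRank

/-! ### The optimal rotation as the right-hand side of the equation for `U`. -/

section Coupled

attribute [local instance] frobeniusTopology in
lemma integrable_outer_of_norm_sq {Ω : Type*} [MeasurableSpace Ω] {P : Measure Ω} {m : ℕ}
    {g : Ω → CVec m} (hg : AEStronglyMeasurable g P) (h : Integrable (fun ω => ‖g ω‖ ^ 2) P) :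
    Integrable (fun ω => outer (g ω) (g ω)) P :=
  integrable_outer hg hg (by simpa only [sq] using h)

attribute [local instance] frobeniusTopology in
lemma I_smul_optG_mul {Ω : Type*} [MeasurableSpace Ω] {P : Measure Ω} {n r N : ℕ}
    {a : CVec n → CVec n} {b : Fin N → CVec n → CVec n} {U : Matrix (Fin n) (Fin r) ℂ}
    {θ : Measure (CVec r)} {Y : Ω → CVec r} (hU : U ∈ stiefel n r) (ha : Measurable a)
    (hb : ∀ j, Measurable (b j)) (hay : Integrable (fun y => outer (a (U *ᵥ y)) y) θ)
    (hY : HasLaw Y θ P) :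
    Complex.I • (optG a b U θ * U) =
      projQ U *
        (expOuter P (fun ω => a (U *ᵥ Y ω)) (fun ω => Y ω) +
          (∑ j, expOuter P (fun ω => b j (U *ᵥ Y ω)) (fun ω => b j (U *ᵥ Y ω))) * U) *
        (expOuter P (fun ω => Y ω) (fun ω => Y ω))⁻¹ := by
  have hUU : Uᴴ * U = 1 := hU
  have haU : Measurable fun y => a (U *ᵥ y) := ha.comp (measurable_mulVec U)
  have hbU : ∀ j, Measurable fun y => b j (U *ᵥ y) := fun j => (hb j).comp (measurable_mulVec U)
  have hay' : Integrable (fun y => outer (a (U *ᵥ y)) (U *ᵥ y)) θ := by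
    simp only [outer_mulVec_right]
    exact integrable_mul_const hay Uᴴ
  -- `optG` contains `E[a (Uy)†] U`, the coupled system `E[a Y†]`; they agree by `U†U = 1`.
  have hE : expOuter θ (fun y => a (U *ᵥ y)) (fun y => U *ᵥ y) * U =
      expOuter θ (fun y => a (U *ᵥ y)) (fun y => y) := by
    have h := integral_mul_const hay' U
    rw [expOuter_eq_integral hay', expOuter_eq_integral hay, ← h]
    simp only [outer_mulVec_right, Matrix.mul_assoc, hUU, Matrix.mul_one]
  rw [expOuter_comp hY haU measurable_id', expOuter_comp hY measurable_id' measurable_id',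
    Finset.sum_congr rfl fun j _ => expOuter_comp hY (hbU j) (hbU j), optG_mul hU, smul_smul,
    ← hE, ← Matrix.add_mul]
  simp [Matrix.mul_assoc]

end Coupled

end SDLR

theorem mainTheorem1 {n r N : ℕ} (T : ℝ) (hT : 0 ≤ T)
    -- the coefficients of the SDE `dX = a(X, t) dt + ∑ⱼ bⱼ(X, t) dWⱼ`
    (a : ℝ → SDLR.CVec n → SDLR.CVec n) (b : Fin N → ℝ → SDLR.CVec n → SDLR.CVec n)
    (ha : Measurable (fun q : ℝ × SDLR.CVec n => a q.1 q.2))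
    (hb : ∀ j, Measurable (fun q : ℝ × SDLR.CVec n => b j q.1 q.2))
    -- the current points of the low-rank manifold
    (U : ℝ → Matrix (Fin n) (Fin r) ℂ) (θ : ℝ → Measure (SDLR.CVec r))
    (hU : ∀ t ∈ Set.Icc 0 T, U t ∈ SDLR.stiefel n r)
    (hθ : ∀ t ∈ Set.Icc 0 T, IsProbabilityMeasure (θ t))
    (hθ₂ : ∀ t ∈ Set.Icc 0 T, Integrable (fun y => ‖y‖ ^ 2) (θ t))
    -- the expectations in the formulas exist
    (ha₂ : ∀ t ∈ Set.Icc 0 T, Integrable (fun y => ‖a t (U t *ᵥ y)‖ * ‖y‖) (θ t))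
    (hb₂ : ∀ t ∈ Set.Icc 0 T, ∀ j, Integrable (fun y => ‖b j t (U t *ᵥ y)‖ ^ 2) (θ t))
    -- `E_θ[y y†]` is invertible
    (hinv : ∀ t ∈ Set.Icc 0 T, IsUnit (SDLR.expOuter (θ t) (fun y => y) (fun y => y))) :
    -- (i), (ii): optimality of the explicit choice, uniqueness of `G`, value of the minimum
    (∀ t ∈ Set.Icc 0 T,
      (SDLR.optParams (a t) (fun j => b j t) (U t) (θ t)).Admissible (U t) (θ t) ∧
      (SDLR.optParams (a t) (fun j => b j t) (U t) (θ t)).residual (a t) (fun j => b j t)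
          (U t) (θ t) =
        ‖∑ j, SDLR.projQ (U t) *
          SDLR.expOuter (θ t) (fun y => b j t (U t *ᵥ y)) (fun y => b j t (U t *ᵥ y)) *
          SDLR.projQ (U t)‖ₑ ∧
      (∀ p : SDLR.Params n r, p.Admissible (U t) (θ t) →
        (SDLR.optParams (a t) (fun j => b j t) (U t) (θ t)).residual (a t) (fun j => b j t)
            (U t) (θ t) ≤
          p.residual (a t) (fun j => b j t) (U t) (θ t)) ∧
      (∀ p : SDLR.Params n r, p.Admissible (U t) (θ t) →
        p.residual (a t) (fun j => b j t) (U t) (θ t) =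
          (SDLR.optParams (a t) (fun j => b j t) (U t) (θ t)).residual (a t) (fun j => b j t)
            (U t) (θ t) →
        p.G = SDLR.optG (a t) (fun j => b j t) (U t) (θ t))) ∧
    -- (iii): the low-rank dynamics with the explicit choice is the coupled ODE-SDE system
    (∀ (Ω : Type*) [mΩ : MeasurableSpace Ω] (P : Measure Ω) [IsProbabilityMeasure P]
      (𝓕 : Filtration ℝ mΩ) (W : Fin N → ℝ → Ω → ℝ) (Y : ℝ → Ω → SDLR.CVec r),
      SDLR.IsBrownianFamily 𝓕 P W → (∀ t ∈ Set.Icc 0 T, HasLaw (Y t) (θ t) P) →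
      (SDLR.IsLowRankDynamics 𝓕 P T W
          (fun t => SDLR.optG (a t) (fun j => b j t) (U t) (θ t))
          (fun t => (SDLR.optParams (a t) (fun j => b j t) (U t) (θ t)).A)
          (fun j t => (SDLR.optParams (a t) (fun j => b j t) (U t) (θ t)).B j) U Y ↔
        SDLR.IsCoupledSystem 𝓕 P T W a b U Y) ∧
      -- full rank: `U` is stationary and `X_LR = U Y` solves the original SDE
      (r = n → SDLR.IsCoupledSystem 𝓕 P T W a b U Y →
        (∀ t ∈ Set.Icc 0 T, HasDerivWithinAt U 0 (Set.Icc 0 T) t) ∧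
        SDLR.SolvesSDE 𝓕 P T W a b (fun t ω => U t *ᵥ Y t ω))) ∧
    -- full rank: the projections are trivial, and the SDE, the generator and the Fokker-Planck
    -- equation of `X_LR` are the original ones
    (r = n →
      (∀ t ∈ Set.Icc 0 T,
        SDLR.projQ (U t) = 0 ∧ SDLR.projP (U t) = 1 ∧
        (SDLR.optParams (a t) (fun j => b j t) (U t) (θ t)).aLR (U t) = a t ∧
        (∀ j, (SDLR.optParams (a t) (fun j => b j t) (U t) (θ t)).bLR (U t) j = b j t) ∧
        ∀ φ : SDLR.CVec n → ℝ, ContDiff ℝ 2 φ →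
          SDLR.generator ((SDLR.optParams (a t) (fun j => b j t) (U t) (θ t)).aLR (U t))
              ((SDLR.optParams (a t) (fun j => b j t) (U t) (θ t)).bLR (U t)) φ =
            SDLR.generator (a t) (fun j => b j t) φ) ∧
      ∀ μ : ℝ → Measure (SDLR.CVec n),
        SDLR.SolvesFokkerPlanck T
            (fun t => (SDLR.optParams (a t) (fun j => b j t) (U t) (θ t)).aLR (U t))
            (fun j t => (SDLR.optParams (a t) (fun j => b j t) (U t) (θ t)).bLR (U t) j) μ ↔
          SDLR.SolvesFokkerPlanck T a b μ) := by
  have hm : ∀ t, Measurable (a t) := fun t => ha.comp measurable_prodMk_left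
  have hm' : ∀ t j, Measurable (b j t) := fun t j => (hb j).comp measurable_prodMk_left
  have hay := fun t (ht : t ∈ Set.Icc 0 T) => SDLR.integrable_outer
    (g := fun y => a t (U t *ᵥ y)) (h := fun y => y)
    ((hm t).comp (SDLR.measurable_mulVec _)).aestronglyMeasurable
    aestronglyMeasurable_id (ha₂ t ht)
  have hbb := fun t (ht : t ∈ Set.Icc 0 T) j => SDLR.integrable_outer_of_norm_sq
    (g := fun y => b j t (U t *ᵥ y))
    ((hm' t j).comp (SDLR.measurable_mulVec _)).aestronglyMeasurable (hb₂ t ht j)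
  have hyy := fun t (ht : t ∈ Set.Icc 0 T) => SDLR.integrable_outer_of_norm_sq
    (g := fun y => y) aestronglyMeasurable_id (hθ₂ t ht)
  refine ⟨fun t ht => ?_, fun Ω mΩ P _ 𝓕 W Y _ hY => ⟨?_, ?_⟩, ?_⟩
  · have hopt := SDLR.admissible_optParams (hU t ht) (hm t) (hm' t) (hyy t ht) (hay t ht)
      (hbb t ht)
    have hab : SDLR.PairingExists (a t) (fun j => b j t) (SDLR.lowRankMeasure (U t) (θ t))
        (SDLR.squareFun n) :=
      (SDLR.pairingExists_lowRankMeasure_iff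
        (SDLR.aestronglyMeasurable_generator_squareFun (hm t) (hm' t) _)).2
        (SDLR.integrable_generator_squareFun (hay t ht) (hbb t ht))
    refine ⟨hopt, ?_, fun p hp => ?_, fun p hp h => ?_⟩
    · rw [SDLR.Params.residual_eq hopt hab, SDLR.defect_optParams (hU t ht) (hay t ht)
        (hbb t ht) (hyy t ht) (hinv t ht) hopt, enorm_neg]
    · rw [SDLR.Params.residual_eq hopt hab, SDLR.Params.residual_eq hp hab, enorm_le_iff_norm_le]
      exact SDLR.norm_defect_optParams_le (hU t ht) (hay t ht) (hbb t ht) (hyy t ht)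
        (hinv t ht) hopt hp
    · rw [SDLR.Params.residual_eq hopt hab, SDLR.Params.residual_eq hp hab] at h
      refine SDLR.eq_optG_of_norm_defect_eq (hU t ht) (hay t ht) (hbb t ht) (hyy t ht)
        (hinv t ht) hopt hp (le_antisymm ?_ ?_)
      · exact enorm_le_iff_norm_le.1 h.le
      · exact enorm_le_iff_norm_le.1 h.ge
  · have hG := fun t ht => SDLR.I_smul_optG_mul (hU t ht) (hm t) (hm' t) (hay t ht) (hY t ht)
    constructor
    · intro h
      exact ⟨h.sde, fun t ht => by rw [← hG t ht]; exact h.ode t ht⟩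
    · intro h
      exact ⟨fun t ht => SDLR.isGauge_optG (hU t ht),
        fun t ht => by rw [hG t ht]; exact h.ode t ht, h.sde⟩
  · rintro rfl h
    have hder : ∀ t ∈ Set.Icc 0 T, HasDerivWithinAt U 0 (Set.Icc 0 T) t := fun t ht => by
      simpa only [SDLR.projQ_of_square (hU t ht), Matrix.zero_mul] using h.ode t ht
    have hconst : ∀ t ∈ Set.Icc 0 T, U t = U 0 := SDLR.eq_of_hasDerivWithinAt_zero hder
    -- Constancy of `U` lets the time-independent map `U 0` undo `U(t)†`, which gives the
    -- intertwining needed for `SolvesSDE.map`.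
    have hmul : ∀ t ∈ Set.Icc 0 T, ∀ v, U 0 *ᵥ (U t)ᴴ *ᵥ v = v := fun t ht v => by
      have hUU : U t * (U t)ᴴ = 1 := SDLR.projP_of_square (hU t ht)
      rw [← hconst t ht, Matrix.mulVec_mulVec, hUU, Matrix.one_mulVec]
    refine ⟨hder, h.sde.map hT (SDLR.mulVecCLM (U 0)) (fun t ht ω => ?_) (fun t ht y => ?_)
      fun j t ht y => ?_⟩
    · rw [hconst t ht, SDLR.mulVecCLM_apply]
    · rw [SDLR.mulVecCLM_apply, SDLR.mulVecCLM_apply, hmul t ht, hconst t ht]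
    · rw [SDLR.mulVecCLM_apply, SDLR.mulVecCLM_apply, hmul t ht, hconst t ht]
  · rintro rfl
    refine ⟨fun t ht => ⟨SDLR.projQ_of_square (hU t ht), SDLR.projP_of_square (hU t ht),
      SDLR.aLR_optParams_of_square (hU t ht), SDLR.bLR_optParams_of_square (hU t ht),
      fun φ _ => ?_⟩, fun μ => ⟨fun h => ?_, fun h => ?_⟩⟩
    · have hbLR : (SDLR.optParams (a t) (fun j => b j t) (U t) (θ t)).bLR (U t) =
          fun j => b j t := funext (SDLR.bLR_optParams_of_square (hU t ht))
      rw [SDLR.aLR_optParams_of_square (hU t ht)]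
      exact congrArg (fun b' => SDLR.generator (a t) b' φ) hbLR
    · exact h.congr (fun t ht => SDLR.aLR_optParams_of_square (hU t ht))
        fun j t ht => SDLR.bLR_optParams_of_square (hU t ht) j
    · exact h.congr (fun t ht => (SDLR.aLR_optParams_of_square (hU t ht)).symm)
        fun j t ht => (SDLR.bLR_optParams_of_square (b := fun j => b j t) (hU t ht) j).symm
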